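/- **Setting.** Let $n\ge 2$, and let $K$ be a field of characteristic $0$ with fixed rational powers $q^r$ and $(-1)^r$ $(r\in\mathbb Q)$, multiplicative in $r$, where $q=q^1\in K^\times$ is not a root of unity and $(-1)^1=-1$ (for instance an algebraic closure of $\mathbb C(q)$). Put $[m]=\frac{q^m-q^{-m}}{q-q^{-1}}$. Let $\alpha_1,\dots,\alpha_{n-1}$ and $\overline\Lambda_1,\dots,\overline\Lambda_{n-1}$ be the simple roots and fundamental weights of $\mathfrak{sl}_n$, $\overline\Lambda_0=\overline\Lambda_n=0$, $\overline Q\subset\overline P$ the root and weight lattices and $(\cdot,\cdot)$ the invariant form with $(\alpha_i,\alpha_i)=2$. The Heisenberg algebra is generated by $a_{i,k}$ ($1\le i\le n-1$, $k\in\mathbb Z\setminus\{0\}$) with $[a_{i,k},a_{j,l}]=\delta_{k+l,0}\frac{[(\alpha_i,\alpha_j)k][k]}{k}$, and $$a^*_{i,k}=\frac1{[k]^2[nk]}\sum_{j=1}^{n-1}[\min(i,j)k]\,[\min(n-i,n-j)k]\,a_{j,k}\quad(1\le i\le n-1),\qquad a^*_{0,k}=a^*_{n,k}=0 .$$ The twisted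 group algebra $K[\overline P]$ has the basis $e^\beta$ $(\beta\in\overline P)$, where $e^{\beta}=e^{m_2\alpha_2}\cdots e^{m_{n-1}\alpha_{n-1}}e^{m_n\overline\Lambda_{n-1}}$ for $\beta=m_2\alpha_2+\dots+m_{n-1}\alpha_{n-1}+m_n\overline\Lambda_{n-1}$, with $e^{\alpha_i}e^{\alpha_j}=(-1)^{(\alpha_i,\alpha_j)}e^{\alpha_j}e^{\alpha_i}$ and $e^{\alpha_i}e^{\overline\Lambda_{n-1}}=(-1)^{\delta_{i,n-1}}e^{\overline\Lambda_{n-1}}e^{\alpha_i}$ for $2\le i,j\le n-1$. On $\mathcal F=K[a_{j,-k}:1\le j\le n-1,\,k>0]\otimes K[\overline P]=\bigoplus_{i=0}^{n-1}\mathcal F_i$, $\mathcal F_i=K[a_{j,-k}]\otimes K[\overline Q]e^{\overline\Lambda_i}$, for $k>0$ the operator $a_{j,-k}$ acts by multiplication and $a_{j,k}$ by $f\otimes e^\beta\mapsto[a_{j,k},f]\otimes e^\beta$; moreover $e^\alpha$ acts by $f\otimes e^\beta\mapsto f\otimes e^\alpha e^\beta$ and $\partial_\alpha$ by the scalar $(\alpha,\beta)$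 on $f\otimes e^\beta$. The level-one currents are the following formal series of operators on $\mathcal F$ (all sums over $k>0$): $$x_j^{\pm}(z)=\exp\Big[\pm\sum\tfrac{a_{j,-k}}{[k]}q^{\mp k/2}z^k\Big]\exp\Big[\mp\sum\tfrac{a_{j,k}}{[k]}q^{\mp k/2}z^{-k}\Big]e^{\pm\alpha_j}z^{\pm\partial_{\alpha_j}+1},$$ $$\varphi_j(z)=\exp\Big[-(q-q^{-1})\sum a_{j,-k}z^k\Big]q^{-\partial_{\alpha_j}},\qquad \psi_j(z)=\exp\Big[(q-q^{-1})\sum a_{j,k}z^{-k}\Big]q^{\partial_{\alpha_j}} .$$ For $0\le i,j\le n-1$ the bosonized vertex operators are $$\Phi^{(i,i+1)}_j(z)=\exp\Big[\sum\big(-a^*_{j,-k}q^{\frac32k}+a^*_{j+1,-k}q^{\frac12k}\big)(q^jz)^k\Big]\exp\Big[\sum\big(-a^*_{j,k}q^{-\frac12k}+a^*_{j+1,k}q^{\frac12k}\big)(q^jz)^{-k}\Big]E_j(z)\,c^i_j,$$ $$\Psi^{(i,i+1)}_j(z)=\exp\Big[\sum\big(-a^*_{j,-k}q^{\frac12k}+a^*_{j+1,-k}q^{-\frac12k}\big)(q^jz)^k\Big]\exp\Big[\sum\big(-a^*_{j,k}q^{-\frac32k}+a^*_{j+1,k}q^{-\frac12k}\big)(q^jz)^{-k}\Big]E_j(z)\,c^i_j,$$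 $$E_j(z)=e^{\overline\Lambda_j-\overline\Lambda_{j+1}}(q^{j+1}z)^{\partial_{\overline\Lambda_j}}(q^jz)^{-\partial_{\overline\Lambda_{j+1}}}(-1)^{(n-1)\partial_{\overline\Lambda_1}},$$ and $\Phi^{*(i+1,i)}_j(z)$, $\Psi^{*(i+1,i)}_j(z)$ are obtained from $\Phi^{(i,i+1)}_j(z)$, $\Psi^{(i,i+1)}_j(z)$ by changing the signs of the exponents in both exponentials, replacing $E_j(z)$ by $e^{-\overline\Lambda_j+\overline\Lambda_{j+1}}(q^{j+1}z)^{-\partial_{\overline\Lambda_j}}(q^jz)^{\partial_{\overline\Lambda_{j+1}}}(-1)^{-(n-1)\partial_{\overline\Lambda_1}}$ and $c^i_j$ by $(c^*)^i_j$. Here the superscripts are read modulo $n$ and $$c^i_j=(-q)^{j-i}\,[(-1)^{-(n-1)}z]^{\frac{n-i-1}n}(-1)^{\frac12(n-i-1)(n-i-2)},\qquad (c^*)^i_j=[(-1)^{n-1}]^{\frac{n-i}n}[q^nz]^{\frac in}(-1)^{\frac12(n-i)(n-i-1)} .$$ The superscripts enter only through these factors; the expressions are regarded as formal series (with rational powers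 of $z$) of operators on $\mathcal F$. The normally ordered product $:\!XY\!:$ of two such expressions is obtained by treating all their factors as commuting symbols and rearranging them so that all $a_{j,-k}$ $(k>0)$ stand to the left of all $a_{j,k}$ $(k>0)$, and all $e^\alpha$ to the left of all $\partial_\beta$, with $e^\alpha,e^\beta$ merged to $e^{\alpha+\beta}$. **Theorem.** For $1\le i\le n-1$ the following identities of formal series of operators on $\mathcal F$ hold: $$\begin{aligned} (1)&\quad :\Phi^{(i-1,i)}_{i-1}(z)\,\Phi^{*(i+1,i)}_{i}(z):\;=\;x_i^-(q^iz),\\ (2)&\quad :\Psi^{(i-1,i)}_{i}(z)\,\Psi^{*(i+1,i)}_{i-1}(z):\;=\;-q\,x_i^+(q^iz),\\ (3)&\quad :x_i^+(q^{\frac12}z)\,x_i^-(q^{-\frac12}z):\;=\;z^2\,\psi_i(z),\\ (4)&\quad :x_i^+(q^{-\frac12}z)\,x_i^-(q^{\frac12}z):\;=\;z^2\,\varphi_i(z). \end{aligned}$$ -/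

import Mathlib

noncomputable section

namespace QVertex

/-- A choice of rational powers in the ground field: `r ↦ q ^ r` and `r ↦ (-1) ^ r`, `r ∈ ℚ`, both
multiplicative in `r`, with `q` not a root of unity. (The operators below involve `q ^ (1/2)`,
`q ^ (1/n)` and `(-1) ^ (1/n)`, so that the ground field has to be an extension of `ℂ(q)`, such as
its algebraic closure; `K = ℂ` with a generic number `q` is covered as well.) -/
structure QPowers (K : Type*) [Field K] where
  qPow : Multiplicative ℚ →* Kˣ
  sPow : Multiplicative ℚ →* Kˣ
  sPow_one : sPow (Multiplicative.ofAdd 1) = -1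
  not_root_of_unity : ∀ m : ℕ, 0 < m → qPow (Multiplicative.ofAdd (m : ℚ)) ≠ 1

section Scalars

variable {K : Type*} [Field K] (P : QPowers K)

/-- `q ^ r` -/
def QPowers.q (r : ℚ) : K := (P.qPow (Multiplicative.ofAdd r) : K)

/-- `(-1) ^ r` -/
def QPowers.s (r : ℚ) : K := (P.sPow (Multiplicative.ofAdd r) : K)

/-- The `q`-integer `[m] = (q ^ m - q ^ (-m)) / (q - q ^ (-1))`. -/
def QPowers.qInt (m : ℤ) : K := (P.q m - P.q (-m)) / (P.q 1 - P.q (-1))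

end Scalars

/-! ### The root datum of `sl_n` -/

/-- The nodes `1, …, n - 1` of the Dynkin diagram of type `A_{n-1}`. -/
abbrev Node (n : ℕ) : Type := {j : ℕ // j ∈ Finset.Ioo 0 n}

/-- The Cartan matrix of type `A`. -/
def cartan (i j : ℕ) : ℤ := if i = j then 2 else if i + 1 = j ∨ j + 1 = i then -1 else 0

/-- The weight lattice of `sl_n`, in coordinates with respect to the fundamental weights. -/
abbrev Wt (n : ℕ) : Type := Node n → ℤ

/-- The (classical part of the) fundamental weight `Λ_j` for `1 ≤ j ≤ n - 1`; it is `0` for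
`j = 0` and `j = n`. -/
def fund (n j : ℕ) : Wt n := fun a => if a.1 = j then 1 else 0

/-- The simple root `α_j = ∑ₐ a_{ja} Λ_a`. -/
def root (n j : ℕ) : Wt n := fun a => cartan j a.1

/-- A weight viewed in the rational span of the weight lattice. -/
def toRat {n : ℕ} (lam : Wt n) : Node n → ℚ := fun a => (lam a : ℚ)

/-- The invariant form, `(Λ_a, Λ_b) = min (a, b) * min (n - a, n - b) / n`, on (rational span) ×
(weight lattice). -/
def form {n : ℕ} (x : Node n → ℚ) (β : Wt n) : ℚ :=
  ∑ a : Node n, ∑ b : Node n,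
    x a * (β b : ℚ) * ((min a.1 b.1 : ℕ) : ℚ) * ((min (n - a.1) (n - b.1) : ℕ) : ℚ) / (n : ℚ)

/-- Coordinates `m_2, …, m_n` of a weight with respect to the free basis
`α_2, …, α_{n-1}, Λ_{n-1}`: for `2 ≤ k ≤ n - 1`, `m_k` is the coefficient of `α_k`, and `m_n` is the
coefficient of `Λ_{n-1}`. They come from
`Λ_j = -α_{j+1} - 2 α_{j+2} - ⋯ - (n-j-1) α_{n-1} + (n-j) Λ_{n-1}`. -/
def mCoord {n : ℕ} (lam : Wt n) (k : ℕ) : ℤ :=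
  if k = n then ∑ j : Node n, ((n : ℤ) - j.1) * lam j
  else -∑ j : Node n, if j.1 < k then ((k : ℤ) - j.1) * lam j else 0

/-- The exponent in `e^lam e^mu = (-1)^ε e^(lam+mu)`. With
`e^lam = e^(m_2 α_2) ⋯ e^(m_{n-1} α_{n-1}) e^(m_n Λ_{n-1})`, where neighbouring generators
anticommute and all other pairs of generators commute, reordering `e^lam e^mu` gives
`ε = ∑_{k=3}^n m_k(lam) m_{k-1}(mu)`. -/
def cocycleExp {n : ℕ} (lam mu : Wt n) : ℤ :=
  ∑ k ∈ Finset.Icc 3 n, mCoord lam k * mCoord mu (k - 1)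

/-! ### The Fock space and the operators on it -/

/-- The direct sum `K[a_{j,-k} : 1 ≤ j ≤ n - 1, k > 0] ⊗ K[weight lattice]` of the Fock spaces
`F_0, …, F_{n-1}`: `Finsupp.single β f` is `f ⊗ e^β`, the variable `X (j, k)` is `a_{j,-k}`, and
`F_i` is spanned by the `f ⊗ e^β` with `β ∈ Λ_i + (root lattice)`. -/
abbrev Fock (n : ℕ) (K : Type*) [Field K] : Type _ := Wt n →₀ MvPolynomial (Node n × ℕ+) K

section Operators

variable {n : ℕ} {K : Type*} [Field K] (P : QPowers K)

/-- The operator `a_{j,-k}`, `k > 0`: multiplication by the variable `a_{j,-k}`. -/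
def heisCre (j : Node n) (k : ℕ+) : Module.End K (Fock n K) :=
  Finsupp.mapRange.linearMap (LinearMap.mulLeft K (MvPolynomial.X (j, k)))

/-- The operator `a_{j,k}`, `k > 0`: the derivation `f ↦ [a_{j,k}, f]`, where
`[a_{j,k}, a_{i,-l}] = δ_{k,l} [(α_j, α_i) k] [k] / k`. -/
def heisAnn (j : Node n) (k : ℕ+) : Module.End K (Fock n K) :=
  Finsupp.mapRange.linearMap
    (MvPolynomial.mkDerivation K (fun il : Node n × ℕ+ =>
      if il.2 = k then
        MvPolynomial.C (P.qInt (cartan j.1 il.1.1 * (k : ℕ)) * P.qInt (k : ℕ) / ((k : ℕ) : K))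
      else 0)).toLinearMap

/-- The operator `e^lam`: `f ⊗ e^β ↦ f ⊗ e^lam e^β`, the product being taken in the twisted group
algebra of the weight lattice. -/
def lattOp (lam : Wt n) : Module.End K (Fock n K) :=
  Finsupp.lsum K fun β =>
    (((cocycleExp lam β).negOnePow : ℤ) : K) • Finsupp.lsingle (lam + β)

/-- The coefficients, with respect to `a_{1,k}, …, a_{n-1,k}`, of
`a*_{i,k} = ([k]² [nk])⁻¹ ∑_j [min (i, j) k] [min (n - i, n - j) k] a_{j,k}`, for `k ≠ 0`. (It is `0`
for `i = 0` and `i = n`.) -/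
def aStar (n : ℕ) (i : ℕ) (k : ℤ) : Node n → K := fun j =>
  P.qInt ((min i j.1 : ℕ) * k) * P.qInt ((min (n - i) (n - j.1) : ℕ) * k)
    / (P.qInt k ^ 2 * P.qInt (n * k))

/-- The coefficients of `a_{j,k}` with respect to `a_{1,k}, …, a_{n-1,k}`. -/
def aVec (n : ℕ) (K : Type*) [Field K] (j : ℕ) : Node n → K := fun a => if a.1 = j then 1 else 0

/-- `exp H = ∑_r H^r / r!` for a power series `H` without constant term; the coefficient of `t^m`
only involves the terms with `r ≤ m`. -/
def expSeries (H : PowerSeries (Module.End K (Fock n K))) :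
    PowerSeries (Module.End K (Fock n K)) :=
  PowerSeries.mk fun m =>
    ∑ r ∈ Finset.range (m + 1), ((r.factorial : K)⁻¹) • PowerSeries.coeff m (H ^ r)

/-- `exp (∑_{k>0} ∑_j u_{k,j} a_{j,-k} t^k)` -/
def creExp (u : ℕ+ → Node n → K) : PowerSeries (Module.End K (Fock n K)) :=
  expSeries (PowerSeries.mk fun k =>
    if h : 0 < k then ∑ j : Node n, u ⟨k, h⟩ j • heisCre j ⟨k, h⟩ else 0)

/-- `exp (∑_{k>0} ∑_j u_{k,j} a_{j,k} t^k)` -/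
def annExp (u : ℕ+ → Node n → K) : PowerSeries (Module.End K (Fock n K)) :=
  expSeries (PowerSeries.mk fun k =>
    if h : 0 < k then ∑ j : Node n, u ⟨k, h⟩ j • heisAnn P j ⟨k, h⟩ else 0)

end Operators

/-! ### Formal operator series and normal ordering -/

/-- A formal series `A(z) = ∑_{s ∈ ℚ} A_s z^s` of operators on the Fock space, given by `s ↦ A_s`. -/
abbrev FormalField (n : ℕ) (K : Type*) [Field K] : Type _ := ℚ → Fock n K → Fock n K

/-- `A(z) ↦ A(q^r z)` -/
def FormalField.scaleArg {n : ℕ} {K : Type*} [Field K] (A : FormalField n K) (P : QPowers K)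
    (r : ℚ) : FormalField n K := fun s v => P.q (r * s) • A s v

/-- `A(z) ↦ z^r A(z)` -/
def FormalField.mulZPow {n : ℕ} {K : Type*} [Field K] (A : FormalField n K) (r : ℚ) :
    FormalField n K := fun s v => A (s - r) v

/-- A bosonic expression in normally ordered form,
`exp[∑ cre_{k,j} a_{j,-k} z^k] exp[∑ ann_{k,j} a_{j,k} z^{-k}] e^wt`
`  z^{∂_zDer} q^{∂_qDer} (-1)^{∂_sDer} · coef · z^zExp`. -/
@[ext]
structure BosonExpr (n : ℕ) (K : Type*) [Field K] where
  cre : ℕ+ → Node n → K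
  ann : ℕ+ → Node n → K
  wt : Wt n
  zDer : Node n → ℚ
  qDer : Node n → ℚ
  sDer : Node n → ℚ
  zExp : ℚ
  coef : K

namespace BosonExpr

variable {n : ℕ} {K : Type*} [Field K]

/-- The formal series of operators on the Fock space defined by a bosonic expression. On `f ⊗ e^β`,
`∂_x` is the scalar `(x, β)`, so that the term with the `i`-th coefficient of the first exponential
and the `l`-th coefficient of the second one has the exponent `i - l + (zDer, β) + zExp` in `z`. On
a given vector only finitely many coefficients of the second exponential do not vanish, so that the
sum is finite. -/
def toField (P : QPowers K) (X : BosonExpr n K) : FormalField n K := fun s v =>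
  v.sum fun β f =>
    ∑ᶠ (il : ℕ × ℕ) (_ : (il.1 : ℚ) - il.2 + form X.zDer β + X.zExp = s),
      (X.coef * P.q (form X.qDer β) * P.s (form X.sDer β)) •
        PowerSeries.coeff il.1 (creExp X.cre)
          (PowerSeries.coeff il.2 (annExp P X.ann)
            (lattOp X.wt (Finsupp.single β f)))

/-- Substitution of `q^r z` for `z` in a bosonic expression. -/
def scaleArg (P : QPowers K) (r : ℚ) (X : BosonExpr n K) : BosonExpr n K where
  cre := fun k j => P.q (r * (k : ℕ)) * X.cre k j
  ann := fun k j => P.q (-(r * (k : ℕ))) * X.ann k j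
  wt := X.wt
  zDer := X.zDer
  qDer := X.qDer + r • X.zDer
  sDer := X.sDer
  zExp := X.zExp
  coef := P.q (r * X.zExp) * X.coef

/-- The normally ordered product `:X Y:`. All factors of `X` and `Y` are treated as commuting
symbols and rearranged: the `a_{j,-k}` to the left of the `a_{j,k}`, the `e^lam` to the left of the
`∂`'s, with `e^lam`, `e^mu` merged to `e^(lam+mu)`. -/
def normalProd (X Y : BosonExpr n K) : BosonExpr n K where
  cre := X.cre + Y.cre
  ann := X.ann + Y.ann
  wt := X.wt + Y.wt
  zDer := X.zDer + Y.zDer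
  qDer := X.qDer + Y.qDer
  sDer := X.sDer + Y.sDer
  zExp := X.zExp + Y.zExp
  coef := X.coef * Y.coef

end BosonExpr

/-! ### The currents at level one -/

section Currents

variable (n : ℕ) {K : Type*} [Field K] (P : QPowers K)

/-- `x_j^+(z) = exp[∑ a_{j,-k}/[k] q^{-k/2} z^k] exp[-∑ a_{j,k}/[k] q^{-k/2} z^{-k}]`
`  e^{α_j} z^{∂_{α_j} + 1}` -/
def xPlus (j : ℕ) : BosonExpr n K where
  cre := fun k => (P.q (-(k : ℕ) / 2) / P.qInt (k : ℕ)) • aVec n K j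
  ann := fun k => (-(P.q (-(k : ℕ) / 2) / P.qInt (k : ℕ))) • aVec n K j
  wt := root n j
  zDer := toRat (root n j)
  qDer := 0
  sDer := 0
  zExp := 1
  coef := 1

/-- `x_j^-(z) = exp[-∑ a_{j,-k}/[k] q^{k/2} z^k] exp[∑ a_{j,k}/[k] q^{k/2} z^{-k}]`
`  e^{-α_j} z^{-∂_{α_j} + 1}` -/
def xMinus (j : ℕ) : BosonExpr n K where
  cre := fun k => (-(P.q ((k : ℕ) / 2) / P.qInt (k : ℕ))) • aVec n K j
  ann := fun k => (P.q ((k : ℕ) / 2) / P.qInt (k : ℕ)) • aVec n K j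
  wt := -root n j
  zDer := -toRat (root n j)
  qDer := 0
  sDer := 0
  zExp := 1
  coef := 1

/-- `φ_j(z) = exp[-(q - q^{-1}) ∑ a_{j,-k} z^k] q^{-∂_{α_j}}` -/
def phiCur (j : ℕ) : BosonExpr n K where
  cre := fun _ => (-(P.q 1 - P.q (-1))) • aVec n K j
  ann := 0
  wt := 0
  zDer := 0
  qDer := -toRat (root n j)
  sDer := 0
  zExp := 0
  coef := 1

/-- `ψ_j(z) = exp[(q - q^{-1}) ∑ a_{j,k} z^{-k}] q^{∂_{α_j}}` -/
def psiCur (j : ℕ) : BosonExpr n K where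
  cre := 0
  ann := fun _ => (P.q 1 - P.q (-1)) • aVec n K j
  wt := 0
  zDer := 0
  qDer := toRat (root n j)
  sDer := 0
  zExp := 0
  coef := 1

/-! ### The vertex operators -/

/-- The number factor of
`(c)_j^i = (-q)^{j-i} [(-1)^{-(n-1)} z]^{(n-i-1)/n} (-1)^{(n-i-1)(n-i-2)/2}`. -/
def cCoef (i j : ℕ) : K :=
  (-P.q 1) ^ ((j : ℤ) - i) * P.s (-((n : ℚ) - 1) * (((n : ℚ) - i - 1) / n))
    * (-1) ^ (((n : ℤ) - i - 1) * ((n : ℤ) - i - 2) / 2)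

/-- The number factor of
`(c*)_j^i = [(-1)^{n-1}]^{(n-i)/n} [q^n z]^{i/n} (-1)^{(n-i)(n-i-1)/2}`. -/
def cStarCoef (i : ℕ) : K :=
  P.s (((n : ℚ) - 1) * (((n : ℚ) - i) / n)) * P.q ((n : ℚ) * ((i : ℚ) / n))
    * (-1) ^ (((n : ℤ) - i) * ((n : ℤ) - i - 1) / 2)

/-- The component `Φ_j^{(i,i+1)}(z)` of the vertex operator of type I:
`exp[-∑ a*_{j,-k} q^{3k/2} (q^j z)^k + ∑ a*_{j+1,-k} q^{k/2} (q^j z)^k]`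
`exp[-∑ a*_{j,k} q^{-k/2} (q^j z)^{-k} + ∑ a*_{j+1,k} q^{k/2} (q^j z)^{-k}]`
`e^{Λ_j - Λ_{j+1}} (q^{j+1} z)^{∂_{Λ_j}} (q^j z)^{-∂_{Λ_{j+1}}} (-1)^{(n-1) ∂_{Λ_1}} (c)_j^i`. -/
def vertexPhi (i j : ℕ) : BosonExpr n K where
  cre := fun k =>
    (-(P.q (3 * (k : ℕ) / 2) * P.q (j * (k : ℕ)))) • aStar P n j (-(k : ℕ))
      + (P.q ((k : ℕ) / 2) * P.q (j * (k : ℕ))) • aStar P n (j + 1) (-(k : ℕ))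
  ann := fun k =>
    (-(P.q (-(k : ℕ) / 2) * P.q (-(j * (k : ℕ))))) • aStar P n j (k : ℕ)
      + (P.q ((k : ℕ) / 2) * P.q (-(j * (k : ℕ)))) • aStar P n (j + 1) (k : ℕ)
  wt := fund n j - fund n (j + 1)
  zDer := toRat (fund n j) - toRat (fund n (j + 1))
  qDer := ((j : ℚ) + 1) • toRat (fund n j) - (j : ℚ) • toRat (fund n (j + 1))
  sDer := ((n : ℚ) - 1) • toRat (fund n 1)
  zExp := ((n : ℚ) - i - 1) / n
  coef := cCoef n P i j

/-- The component `Ψ_j^{(i,i+1)}(z)` of the vertex operator of type II: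
`exp[-∑ a*_{j,-k} q^{k/2} (q^j z)^k + ∑ a*_{j+1,-k} q^{-k/2} (q^j z)^k]`
`exp[-∑ a*_{j,k} q^{-3k/2} (q^j z)^{-k} + ∑ a*_{j+1,k} q^{-k/2} (q^j z)^{-k}]`
`e^{Λ_j - Λ_{j+1}} (q^{j+1} z)^{∂_{Λ_j}} (q^j z)^{-∂_{Λ_{j+1}}} (-1)^{(n-1) ∂_{Λ_1}} (c)_j^i`. -/
def vertexPsi (i j : ℕ) : BosonExpr n K where
  cre := fun k =>
    (-(P.q ((k : ℕ) / 2) * P.q (j * (k : ℕ)))) • aStar P n j (-(k : ℕ))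
      + (P.q (-(k : ℕ) / 2) * P.q (j * (k : ℕ))) • aStar P n (j + 1) (-(k : ℕ))
  ann := fun k =>
    (-(P.q (-(3 * (k : ℕ)) / 2) * P.q (-(j * (k : ℕ))))) • aStar P n j (k : ℕ)
      + (P.q (-(k : ℕ) / 2) * P.q (-(j * (k : ℕ)))) • aStar P n (j + 1) (k : ℕ)
  wt := fund n j - fund n (j + 1)
  zDer := toRat (fund n j) - toRat (fund n (j + 1))
  qDer := ((j : ℚ) + 1) • toRat (fund n j) - (j : ℚ) • toRat (fund n (j + 1))
  sDer := ((n : ℚ) - 1) • toRat (fund n 1)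
  zExp := ((n : ℚ) - i - 1) / n
  coef := cCoef n P i j

/-- The component `Φ*_j^{(i+1,i)}(z)` of the dual vertex operator of type I:
`exp[∑ a*_{j,-k} q^{3k/2} (q^j z)^k - ∑ a*_{j+1,-k} q^{k/2} (q^j z)^k]`
`exp[∑ a*_{j,k} q^{-k/2} (q^j z)^{-k} - ∑ a*_{j+1,k} q^{k/2} (q^j z)^{-k}]`
`e^{-Λ_j + Λ_{j+1}} (q^{j+1} z)^{-∂_{Λ_j}} (q^j z)^{∂_{Λ_{j+1}}} (-1)^{-(n-1) ∂_{Λ_1}} (c*)_j^i`. -/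
def vertexPhiStar (i j : ℕ) : BosonExpr n K where
  cre := fun k =>
    (P.q (3 * (k : ℕ) / 2) * P.q (j * (k : ℕ))) • aStar P n j (-(k : ℕ))
      - (P.q ((k : ℕ) / 2) * P.q (j * (k : ℕ))) • aStar P n (j + 1) (-(k : ℕ))
  ann := fun k =>
    (P.q (-(k : ℕ) / 2) * P.q (-(j * (k : ℕ)))) • aStar P n j (k : ℕ)
      - (P.q ((k : ℕ) / 2) * P.q (-(j * (k : ℕ)))) • aStar P n (j + 1) (k : ℕ)
  wt := -fund n j + fund n (j + 1)
  zDer := -toRat (fund n j) + toRat (fund n (j + 1))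
  qDer := -(((j : ℚ) + 1) • toRat (fund n j)) + (j : ℚ) • toRat (fund n (j + 1))
  sDer := (-((n : ℚ) - 1)) • toRat (fund n 1)
  zExp := (i : ℚ) / n
  coef := cStarCoef n P i

/-- The component `Ψ*_j^{(i+1,i)}(z)` of the dual vertex operator of type II:
`exp[∑ a*_{j,-k} q^{k/2} (q^j z)^k - ∑ a*_{j+1,-k} q^{-k/2} (q^j z)^k]`
`exp[∑ a*_{j,k} q^{-3k/2} (q^j z)^{-k} - ∑ a*_{j+1,k} q^{-k/2} (q^j z)^{-k}]`
`e^{-Λ_j + Λ_{j+1}} (q^{j+1} z)^{-∂_{Λ_j}} (q^j z)^{∂_{Λ_{j+1}}} (-1)^{-(n-1) ∂_{Λ_1}} (c*)_j^i`. -/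
def vertexPsiStar (i j : ℕ) : BosonExpr n K where
  cre := fun k =>
    (P.q ((k : ℕ) / 2) * P.q (j * (k : ℕ))) • aStar P n j (-(k : ℕ))
      - (P.q (-(k : ℕ) / 2) * P.q (j * (k : ℕ))) • aStar P n (j + 1) (-(k : ℕ))
  ann := fun k =>
    (P.q (-(3 * (k : ℕ)) / 2) * P.q (-(j * (k : ℕ)))) • aStar P n j (k : ℕ)
      - (P.q (-(k : ℕ) / 2) * P.q (-(j * (k : ℕ)))) • aStar P n (j + 1) (k : ℕ)
  wt := -fund n j + fund n (j + 1)
  zDer := -toRat (fund n j) + toRat (fund n (j + 1))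
  qDer := -(((j : ℚ) + 1) • toRat (fund n j)) + (j : ℚ) • toRat (fund n (j + 1))
  sDer := (-((n : ℚ) - 1)) • toRat (fund n 1)
  zExp := (i : ℚ) / n
  coef := cStarCoef n P i

end Currents

end QVertex

end

/-! Normal ordering discards all commutators and cocycle signs, so the exponents of two factors
simply add and their scalars multiply. Each identity is therefore an equality of bosonic
expressions, checked component by component; neither the Heisenberg relations nor the twisted
multiplication of the weight lattice is needed.

In (1) and (2) the lattice parts combine through `α_i = 2 Λ_i - Λ_{i-1} - Λ_{i+1}`, and the
oscillator parts through its `q`-deformation `(q^k + q^(-k)) a*_{i,k} - a*_{i-1,k} - a*_{i+1,k} =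
a_{i,k} / [k]` (`aStar_recurrence`). The operators `(-1)^{±(n-1)∂_{Λ_1}}` cancel, and the product of
the scalars `c`, `c*` loses its fractional powers (`cCoef_mul_cStarCoef`); what survives is the
scale factor `q^i`, together with `-q` in (2).

In (3) and (4) the lattice operators cancel. One of the two exponentials disappears, and in the
other the coefficient collapses by `(q^k - q^(-k)) / [k] = q - q^(-1)`.

To pass from expressions to operators, `toField` has to respect `z ↦ q^r z`, scalar factors and
powers of `z`. Only the first takes work: rescaling the variable commutes with the exponential of a
power series. -/

namespace QVertex

/-! ### Powers of `q`, `q`-integers, and the inverse of the `q`-Cartan matrix -/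

section Scalars

variable {K : Type*} [Field K] (P : QPowers K)

theorem QPowers.q_add (r t : ℚ) : P.q (r + t) = P.q r * P.q t := by
  simp [QPowers.q, ofAdd_add]

theorem QPowers.q_zero : P.q 0 = 1 := by
  simp [QPowers.q]

theorem QPowers.q_ne_zero (r : ℚ) : P.q r ≠ 0 := Units.ne_zero _

theorem QPowers.q_neg (r : ℚ) : P.q (-r) = (P.q r)⁻¹ := by
  simp [QPowers.q, ofAdd_neg]

theorem QPowers.q_natCast_mul (m : ℕ) (r : ℚ) : P.q (m * r) = P.q r ^ m := by
  induction m with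
  | zero => simp [P.q_zero]
  | succ m ih => rw [Nat.cast_succ, add_mul, one_mul, P.q_add, ih, pow_succ]

theorem QPowers.q_eq_half_sq (k : ℚ) : P.q k = P.q (k / 2) ^ 2 := by
  rw [← P.q_natCast_mul]
  congr 1
  push_cast
  ring

theorem QPowers.q_three_halves (k : ℚ) : P.q (3 * k / 2) = P.q (k / 2) ^ 3 := by
  rw [← P.q_natCast_mul]
  congr 1
  push_cast
  ring

theorem QPowers.q_neg_three_halves (k : ℚ) : P.q (-(3 * k) / 2) = P.q (-k / 2) ^ 3 := by
  rw [← P.q_three_halves, mul_neg]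

theorem QPowers.q_half_mul_q_neg_half (k : ℚ) : P.q (k / 2) * P.q (-k / 2) = 1 := by
  rw [← P.q_add, ← P.q_zero]
  congr 1
  ring

theorem QPowers.q_succ_mul (j k : ℚ) : P.q ((j + 1) * k) = P.q (j * k) * P.q (k / 2) ^ 2 := by
  rw [add_mul, one_mul, P.q_add, P.q_eq_half_sq k]

theorem QPowers.q_neg_succ_mul (j k : ℚ) :
    P.q (-((j + 1) * k)) = P.q (-(j * k)) * P.q (-k / 2) ^ 2 := by
  rw [add_mul, one_mul, neg_add, P.q_add, P.q_eq_half_sq (-k)]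

theorem QPowers.s_add (r t : ℚ) : P.s (r + t) = P.s r * P.s t := by
  simp [QPowers.s, ofAdd_add]

theorem QPowers.s_zero : P.s 0 = 1 := by
  simp [QPowers.s]

theorem QPowers.q_natCast_ne_one {m : ℕ} (hm : 0 < m) : P.q (m : ℚ) ≠ 1 := fun h =>
  P.not_root_of_unity m hm (Units.ext h)

/-- Equality `q^m = q^(-m)` would force `q^(2m) = 1`. This is where it matters that `q` is not a
root of unity. -/
theorem QPowers.q_sub_q_neg_ne_zero {m : ℕ} (hm : 0 < m) : P.q (m : ℚ) - P.q (-(m : ℚ)) ≠ 0 := by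
  intro h
  refine P.q_natCast_ne_one (m := m + m) (by omega) ?_
  rw [sub_eq_zero] at h
  rw [Nat.cast_add, P.q_add]
  nth_rewrite 1 [h]
  rw [← P.q_add, neg_add_cancel, P.q_zero]

theorem QPowers.q_one_sub_ne_zero : P.q 1 - P.q (-1) ≠ 0 := by
  simpa using P.q_sub_q_neg_ne_zero one_pos

theorem QPowers.qInt_natCast_ne_zero {m : ℕ} (hm : 0 < m) : P.qInt (m : ℤ) ≠ 0 := by
  unfold QPowers.qInt
  exact div_ne_zero (by simpa using P.q_sub_q_neg_ne_zero hm) P.q_one_sub_ne_zero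

theorem QPowers.qInt_neg (m : ℤ) : P.qInt (-m) = -P.qInt m := by
  simp only [QPowers.qInt, Int.cast_neg, neg_neg]
  rw [← neg_sub, neg_div]

/-- `(q^m - q^(-m)) / [m] = q - q^(-1)` -/
theorem QPowers.sub_div_qInt {m : ℕ} (hm : 0 < m) :
    (P.q (m : ℚ) - P.q (-(m : ℚ))) / P.qInt (m : ℤ) = P.q 1 - P.q (-1) := by
  have h1 := P.q_sub_q_neg_ne_zero hm
  have h2 := P.q_one_sub_ne_zero
  simp only [QPowers.qInt, Int.cast_natCast]
  field_simp

/-- `(q^b + q^(-b)) [a] = [a + b] + [a - b]` -/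
theorem QPowers.qInt_add_add_qInt_sub (a b : ℤ) :
    (P.q (b : ℚ) + P.q (-(b : ℚ))) * P.qInt a = P.qInt (a + b) + P.qInt (a - b) := by
  simp only [QPowers.qInt, Int.cast_add, Int.cast_neg, sub_eq_add_neg, neg_add, neg_neg, P.q_add]
  ring

/-- `[a + b] [c + b] - [a] [c] = [b] [a + b + c]` -/
theorem QPowers.qInt_mul_sub_mul (a b c : ℤ) :
    P.qInt (a + b) * P.qInt (c + b) - P.qInt a * P.qInt c = P.qInt b * P.qInt (a + b + c) := by
  have h1 := P.q_one_sub_ne_zero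
  have ha := P.q_ne_zero a
  have hb := P.q_ne_zero b
  have hc := P.q_ne_zero c
  -- Once the two products on the left are expanded, the mixed terms `q^(a-c)` and `q^(c-a)` occur
  -- in both and cancel.
  simp only [QPowers.qInt, Int.cast_add, neg_add, P.q_add, P.q_neg] at *
  field_simp
  ring

/-- The vectors `a*_{i,k}` are inverted by the `q`-Cartan matrix:
`(q^k + q^(-k)) a*_{i,k} - a*_{i-1,k} - a*_{i+1,k} = a_{i,k} / [k]`. -/
theorem aStar_recurrence {n i : ℕ} (hin : i + 1 < n) {k : ℤ} (hk : P.qInt k ≠ 0)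
    (hnk : P.qInt (n * k) ≠ 0) :
    (P.q k + P.q (-k)) • aStar P n (i + 1) k - aStar P n i k - aStar P n (i + 1 + 1) k
      = (P.qInt k)⁻¹ • aVec n K (i + 1) := by
  funext j
  obtain ⟨j, hj⟩ := j
  rw [Finset.mem_Ioo] at hj
  simp only [aStar, aVec, Pi.sub_apply, Pi.smul_apply, smul_eq_mul]
  -- `a*` is the Green's function of a `q`-deformed Laplacian on a path: away from the diagonal one
  -- `q`-integer is constant in `i` and the other solves the three-term recurrence. The values at
  -- the nodes `0` and `n` vanish because `[0] = 0`, so the ends need no separate case.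
  rcases lt_trichotomy j (i + 1) with h | h | h
  · obtain ⟨d, rfl⟩ : ∃ d, n = i + 2 + d := ⟨n - (i + 2), by omega⟩
    rw [if_neg (by omega), min_eq_right (by omega : j ≤ i + 1), min_eq_right (by omega : j ≤ i),
      min_eq_right (by omega : j ≤ i + 1 + 1),
      min_eq_left (by omega : i + 2 + d - (i + 1) ≤ i + 2 + d - j),
      min_eq_left (by omega : i + 2 + d - i ≤ i + 2 + d - j),
      min_eq_left (by omega : i + 2 + d - (i + 1 + 1) ≤ i + 2 + d - j),
      show i + 2 + d - (i + 1) = d + 1 by omega, show i + 2 + d - i = d + 2 by omega,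
      show i + 2 + d - (i + 1 + 1) = d by omega]
    have := P.qInt_add_add_qInt_sub (((d + 1 : ℕ) : ℤ) * k) k
    rw [show ((d + 1 : ℕ) : ℤ) * k + k = ((d + 2 : ℕ) : ℤ) * k by push_cast; ring,
      show ((d + 1 : ℕ) : ℤ) * k - k = (d : ℤ) * k by push_cast; ring] at this
    field_simp
    linear_combination P.qInt (j * k) * this
  · subst h
    obtain ⟨d, rfl⟩ : ∃ d, n = i + 2 + d := ⟨n - (i + 2), by omega⟩
    rw [if_pos rfl, min_self, min_self, min_eq_left (by omega : i ≤ i + 1),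
      min_eq_right (by omega : i + 1 ≤ i + 1 + 1),
      min_eq_right (by omega : i + 2 + d - (i + 1) ≤ i + 2 + d - i),
      min_eq_left (by omega : i + 2 + d - (i + 1 + 1) ≤ i + 2 + d - (i + 1)),
      show i + 2 + d - (i + 1) = d + 1 by omega,
      show i + 2 + d - (i + 1 + 1) = d by omega]
    -- On the diagonal, `h1` reduces the numerator to `[(i+2)k] [(d+1)k] - [(i+1)k] [dk]`, and `h2`
    -- evaluates this as `[k] [nk]`, cancelling all of the denominator but one `[k]`.
    have h1 := P.qInt_add_add_qInt_sub (((i + 1 : ℕ) : ℤ) * k) k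
    have h2 := P.qInt_mul_sub_mul (((i + 1 : ℕ) : ℤ) * k) k ((d : ℤ) * k)
    rw [show ((i + 1 : ℕ) : ℤ) * k + k + (d : ℤ) * k = ((i + 2 + d : ℕ) : ℤ) * k by
        push_cast; ring,
      show (d : ℤ) * k + k = ((d + 1 : ℕ) : ℤ) * k by push_cast; ring] at h2
    rw [show ((i + 1 : ℕ) : ℤ) * k - k = (i : ℤ) * k by push_cast; ring] at h1
    field_simp
    linear_combination P.qInt (((d + 1 : ℕ) : ℤ) * k) * h1 + h2
  · obtain ⟨d, rfl⟩ : ∃ d, n = j + d := ⟨n - j, by omega⟩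
    rw [if_neg (by omega), min_eq_left (by omega : i + 1 ≤ j), min_eq_left (by omega : i ≤ j),
      min_eq_left (by omega : i + 1 + 1 ≤ j),
      min_eq_right (by omega : j + d - j ≤ j + d - (i + 1)),
      min_eq_right (by omega : j + d - j ≤ j + d - i),
      min_eq_right (by omega : j + d - j ≤ j + d - (i + 1 + 1))]
    have := P.qInt_add_add_qInt_sub (((i + 1 : ℕ) : ℤ) * k) k
    rw [show ((i + 1 : ℕ) : ℤ) * k + k = ((i + 1 + 1 : ℕ) : ℤ) * k by push_cast; ring,
      show ((i + 1 : ℕ) : ℤ) * k - k = (i : ℤ) * k by push_cast; ring] at this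
    field_simp
    linear_combination P.qInt (((j + d - j : ℕ) : ℤ) * k) * this

theorem aStar_recurrence_natCast {n i : ℕ} (hin : i + 1 < n) {k : ℕ} (hk : 0 < k) :
    (P.q k + P.q (-k)) • aStar P n (i + 1) k - aStar P n i k - aStar P n (i + 1 + 1) k
      = (P.qInt k)⁻¹ • aVec n K (i + 1) := by
  have h := P.qInt_natCast_ne_zero (m := n * k) (Nat.mul_pos (by omega) hk)
  rw [Nat.cast_mul] at h
  simpa using aStar_recurrence P hin (P.qInt_natCast_ne_zero hk) h

/-- The `q`-Cartan factor is even in `k` and `[k]` is odd, hence the sign on the right. It accounts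
for the opposite signs of the two exponentials in `x_i^±`. -/
theorem aStar_recurrence_neg_natCast {n i : ℕ} (hin : i + 1 < n) {k : ℕ} (hk : 0 < k) :
    (P.q k + P.q (-k)) • aStar P n (i + 1) (-k) - aStar P n i (-k) - aStar P n (i + 1 + 1) (-k)
      = (-(P.qInt k)⁻¹) • aVec n K (i + 1) := by
  have h := P.qInt_natCast_ne_zero (m := n * k) (Nat.mul_pos (by omega) hk)
  rw [Nat.cast_mul] at h
  have := aStar_recurrence P hin (k := -(k : ℤ))
    (by rw [P.qInt_neg]; exact neg_ne_zero.2 (P.qInt_natCast_ne_zero hk))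
    (by rw [mul_neg, P.qInt_neg]; exact neg_ne_zero.2 h)
  rw [P.qInt_neg, inv_neg] at this
  simpa [add_comm] using this

end Scalars

/-! ### Substitution `z ↦ q^r z`, scalars and powers of `z` at the level of operators -/

section Rescaling

variable {n : ℕ} {K : Type*} [Field K] (P : QPowers K)

/-- Weights multiplicative in the degree define a ring endomorphism of power series. They are
central scalars, so noncommuting coefficients do no harm. Used with `w m = q^(rm)` for creation and
`w m = q^(-rm)` for annihilation. -/
theorem coeff_pow_of_rescaled {A : Type*} [Semiring A] [Algebra K A] {w : ℕ → K} (w_zero : w 0 = 1)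
    (w_add : ∀ a b, w (a + b) = w a * w b) {F G : PowerSeries A}
    (h : ∀ m, PowerSeries.coeff m F = w m • PowerSeries.coeff m G) (r m : ℕ) :
    PowerSeries.coeff m (F ^ r) = w m • PowerSeries.coeff m (G ^ r) := by
  induction r generalizing m with
  | zero =>
    rw [pow_zero, pow_zero, PowerSeries.coeff_one]
    split_ifs with hm
    · rw [hm, w_zero, one_smul]
    · rw [smul_zero]
  | succ r ih =>
    rw [pow_succ, pow_succ, PowerSeries.coeff_mul, PowerSeries.coeff_mul, Finset.smul_sum]
    refine Finset.sum_congr rfl fun ab hab => ?_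
    rw [ih, h, smul_mul_smul_comm, ← w_add, Finset.HasAntidiagonal.mem_antidiagonal.1 hab]

theorem coeff_expSeries_of_rescaled {w : ℕ → K} (w_zero : w 0 = 1)
    (w_add : ∀ a b, w (a + b) = w a * w b) {F G : PowerSeries (Module.End K (Fock n K))}
    (h : ∀ m, PowerSeries.coeff m F = w m • PowerSeries.coeff m G) (m : ℕ) :
    PowerSeries.coeff m (expSeries F) = w m • PowerSeries.coeff m (expSeries G) := by
  rw [expSeries, expSeries, PowerSeries.coeff_mk, PowerSeries.coeff_mk, Finset.smul_sum]
  refine Finset.sum_congr rfl fun r _ => ?_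
  rw [coeff_pow_of_rescaled w_zero w_add h, smul_comm]

theorem coeff_creExp_rescaled {w : ℕ → K} (w_zero : w 0 = 1)
    (w_add : ∀ a b, w (a + b) = w a * w b) (u : ℕ+ → Node n → K) (m : ℕ) :
    PowerSeries.coeff m (creExp fun k j => w k * u k j)
      = w m • PowerSeries.coeff m (creExp u) := by
  refine coeff_expSeries_of_rescaled w_zero w_add (fun k => ?_) m
  rw [PowerSeries.coeff_mk, PowerSeries.coeff_mk]
  split_ifs with h
  · simp only [PNat.mk_coe, Finset.smul_sum, mul_smul]
  · rw [smul_zero]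

theorem coeff_annExp_rescaled {w : ℕ → K} (w_zero : w 0 = 1)
    (w_add : ∀ a b, w (a + b) = w a * w b) (u : ℕ+ → Node n → K) (m : ℕ) :
    PowerSeries.coeff m (annExp P fun k j => w k * u k j)
      = w m • PowerSeries.coeff m (annExp P u) := by
  refine coeff_expSeries_of_rescaled w_zero w_add (fun k => ?_) m
  rw [PowerSeries.coeff_mk, PowerSeries.coeff_mk]
  split_ifs with h
  · simp only [PNat.mk_coe, Finset.smul_sum, mul_smul]
  · rw [smul_zero]

theorem form_add_smul (x y : Node n → ℚ) (r : ℚ) (β : Wt n) :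
    form (x + r • y) β = form x β + r * form y β := by
  simp only [form, Finset.mul_sum, ← Finset.sum_add_distrib]
  refine Finset.sum_congr rfl fun a _ => Finset.sum_congr rfl fun b _ => ?_
  simp only [Pi.add_apply, Pi.smul_apply, smul_eq_mul]
  ring

/-- Substituting `q^r z` for `z` in an expression and in its operator series agree. -/
theorem BosonExpr.toField_scaleArg (r : ℚ) (X : BosonExpr n K) :
    (X.scaleArg P r).toField P = (X.toField P).scaleArg P r := by
  funext t v
  simp only [BosonExpr.toField, FormalField.scaleArg, Finsupp.smul_sum]
  refine Finsupp.sum_congr fun β _ => ?_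
  rw [smul_finsum]
  refine finsum_congr fun il => ?_
  rw [smul_finsum]
  refine finsum_congr fun hil => ?_
  have hil' : (il.1 : ℚ) - il.2 + form X.zDer β + X.zExp = t := hil
  have hc := coeff_creExp_rescaled (n := n) (w := fun m => P.q (r * m)) (by simp [P.q_zero])
    (fun a b => by rw [Nat.cast_add, mul_add, P.q_add]) X.cre il.1
  have ha := coeff_annExp_rescaled P (n := n) (w := fun m => P.q (-(r * m))) (by simp [P.q_zero])
    (fun a b => by rw [Nat.cast_add, mul_add, neg_add, P.q_add]) X.ann il.2
  simp only [BosonExpr.scaleArg]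
  rw [hc, ha, form_add_smul]
  simp only [LinearMap.smul_apply, map_smul, smul_smul]
  congr 1
  -- The total exponent of `z` is a sum of four contributions, and `q^(rt)` splits accordingly:
  -- creation degree, annihilation degree, `∂_zDer` (absorbed in `qDer`) and `zExp` (absorbed in
  -- `coef`).
  rw [← hil', show r * ((il.1 : ℚ) - il.2 + form X.zDer β + X.zExp)
    = r * il.1 + -(r * il.2) + r * form X.zDer β + r * X.zExp by ring]
  simp only [P.q_add]
  ring

/-- A number factor can be taken out of a bosonic expression. -/
theorem BosonExpr.toField_smul_coef (c : K) (X : BosonExpr n K) :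
    ({X with coef := c * X.coef} : BosonExpr n K).toField P = c • X.toField P := by
  funext t v
  simp only [BosonExpr.toField, Pi.smul_apply, Finsupp.smul_sum]
  refine Finsupp.sum_congr fun β _ => ?_
  rw [smul_finsum]
  refine finsum_congr fun il => ?_
  rw [smul_finsum]
  refine finsum_congr fun _ => ?_
  rw [smul_smul, mul_assoc c, mul_assoc c]

/-- A power of `z` can be taken out of a bosonic expression. -/
theorem BosonExpr.toField_add_zExp (r : ℚ) (X : BosonExpr n K) :
    ({X with zExp := X.zExp + r} : BosonExpr n K).toField P = (X.toField P).mulZPow r := by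
  funext t v
  simp only [BosonExpr.toField, FormalField.mulZPow, eq_sub_iff_add_eq, add_assoc]

end Rescaling

/-! ### Simple roots in terms of fundamental weights -/

section RootDatum

/-- `α_i = 2 Λ_i - Λ_{i-1} - Λ_{i+1}` -/
theorem root_succ_eq (n i : ℕ) :
    root n (i + 1) = fund n (i + 1) + fund n (i + 1) - fund n i - fund n (i + 1 + 1) := by
  funext a
  simp only [root, fund, cartan, Pi.add_apply, Pi.sub_apply]
  split_ifs <;> omega

theorem toRat_root_succ (n i : ℕ) :
    toRat (root n (i + 1)) = toRat (fund n (i + 1)) + toRat (fund n (i + 1))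
      - toRat (fund n i) - toRat (fund n (i + 1 + 1)) := by
  funext a
  simp [toRat, root_succ_eq]

end RootDatum

/-! ### The four normally ordered products as bosonic expressions -/

section NormalProducts

variable {n i : ℕ} {K : Type*} [Field K] (P : QPowers K)

theorem sign_mul_self (m : ℤ) : ((-1 : K) ^ m) * (-1) ^ m = 1 := by
  rw [← mul_zpow]; simp

/-- The fractional powers of `-1` have opposite exponents, and the two quadratic signs have the same
exponent, so their product is a square. The factor `(-q)^(j-i)` is `1` in identity (1) and `-q` in
identity (2). -/
theorem cCoef_mul_cStarCoef (hin : i + 1 < n) (j : ℕ) :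
    cCoef n P i j * cStarCoef n P (i + 1) = (-P.q 1) ^ ((j : ℤ) - i) * P.q ((i : ℚ) + 1) := by
  have hn : (n : ℚ) ≠ 0 := by
    have : n ≠ 0 := by omega
    exact_mod_cast this
  have hs : P.s (-((n : ℚ) - 1) * (((n : ℚ) - i - 1) / n))
      * P.s (((n : ℚ) - 1) * (((n : ℚ) - (i + 1 : ℕ)) / n)) = 1 := by
    rw [← P.s_add, ← P.s_zero]
    congr 1
    push_cast
    ring
  have hq : P.q ((n : ℚ) * (((i + 1 : ℕ) : ℚ) / n)) = P.q ((i : ℚ) + 1) := by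
    congr 1
    push_cast
    field_simp
  have he : ((n : ℤ) - (i + 1 : ℕ)) * ((n : ℤ) - (i + 1 : ℕ) - 1) / 2
      = ((n : ℤ) - i - 1) * ((n : ℤ) - i - 2) / 2 := by
    congr 1
    push_cast
    ring
  have hm := sign_mul_self (K := K) (((n : ℤ) - i - 1) * ((n : ℤ) - i - 2) / 2)
  rw [cCoef, cStarCoef, hq, he]
  generalize (-1 : K) ^ (((n : ℤ) - i - 1) * ((n : ℤ) - i - 2) / 2) = e at *
  linear_combination (-P.q 1) ^ ((j : ℤ) - i) * P.q ((i : ℚ) + 1) * (e * e * hs + hm)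

theorem normalProd_vertexPhi_vertexPhiStar (hin : i + 1 < n) :
    (vertexPhi n P i i).normalProd (vertexPhiStar n P (i + 1) (i + 1))
      = (xMinus n P (i + 1)).scaleArg P (i + 1) := by
  have hn : (n : ℚ) ≠ 0 := by
    have : n ≠ 0 := by omega
    exact_mod_cast this
  ext1
  · funext k j
    have h := congrFun (aStar_recurrence_neg_natCast P hin k.pos) j
    simp only [BosonExpr.normalProd, vertexPhi, vertexPhiStar, BosonExpr.scaleArg, xMinus,
      Pi.add_apply, Pi.sub_apply, Pi.smul_apply, smul_eq_mul, Nat.cast_add, Nat.cast_one] at h ⊢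
    have hxw := P.q_half_mul_q_neg_half (k : ℕ)
    rw [P.q_eq_half_sq (k : ℕ), P.q_eq_half_sq (-(k : ℕ))] at h
    simp only [P.q_three_halves, P.q_succ_mul]
    generalize P.q ((k : ℕ) / 2) = x at *
    generalize P.q (-(k : ℕ) / 2) = w at *
    -- With `x = q^(k/2)` and `w = q^(-k/2)`, the factor `q^(ik) x^3` is common to all terms and
    -- leaves exactly the recurrence; the multiple of `hxw` only normalises `x w = 1`. The other
    -- three oscillator computations run the same way.
    linear_combination P.q (i * (k : ℕ)) * x ^ 3 * h - P.q (i * (k : ℕ)) * x * aStar P n (i + 1) (-(k : ℕ)) j * (x * w + 1) * hxw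
  · funext k j
    have h := congrFun (aStar_recurrence_natCast P hin k.pos) j
    simp only [BosonExpr.normalProd, vertexPhi, vertexPhiStar, BosonExpr.scaleArg, xMinus,
      Pi.add_apply, Pi.sub_apply, Pi.smul_apply, smul_eq_mul, Nat.cast_add, Nat.cast_one] at h ⊢
    have hxw := P.q_half_mul_q_neg_half (k : ℕ)
    rw [P.q_eq_half_sq (k : ℕ), P.q_eq_half_sq (-(k : ℕ))] at h
    simp only [P.q_neg_succ_mul]
    generalize P.q ((k : ℕ) / 2) = x at *
    generalize P.q (-(k : ℕ) / 2) = w at *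
    linear_combination P.q (-(i * (k : ℕ))) * w * h - P.q (-(i * (k : ℕ))) * (x * aStar P n (i + 1) (k : ℕ) j + w * (aStar P n (i + 1 + 1) (k : ℕ) j + (P.qInt (k : ℕ))⁻¹ * aVec n K (i + 1) j)) * hxw
  · simp only [BosonExpr.normalProd, vertexPhi, vertexPhiStar, BosonExpr.scaleArg, xMinus,
      root_succ_eq]
    abel
  · simp only [BosonExpr.normalProd, vertexPhi, vertexPhiStar, BosonExpr.scaleArg, xMinus,
      toRat_root_succ]
    abel
  -- The differing shifts `q^(j+1) z` and `q^j z` combine: `Λ_{i+1}` receives `-i - (i+2) =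
  -- -2(i+1)`, while `Λ_i` and `Λ_{i+2}` receive `i+1`, giving `-(i+1) α_{i+1}`, as scaling `z` by
  -- `q^(i+1)` requires.
  · simp only [BosonExpr.normalProd, vertexPhi, vertexPhiStar, BosonExpr.scaleArg, xMinus,
      toRat_root_succ]
    push_cast
    module
  · simp only [BosonExpr.normalProd, vertexPhi, vertexPhiStar, BosonExpr.scaleArg, xMinus]
    module
  · simp only [BosonExpr.normalProd, vertexPhi, vertexPhiStar, BosonExpr.scaleArg, xMinus]
    push_cast
    field_simp
    ring
  · simp only [BosonExpr.normalProd, vertexPhi, vertexPhiStar, BosonExpr.scaleArg, xMinus,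
      cCoef_mul_cStarCoef P hin]
    simp

theorem normalProd_vertexPsi_vertexPsiStar (hin : i + 1 < n) :
    (vertexPsi n P i (i + 1)).normalProd (vertexPsiStar n P (i + 1) i)
      = {(xPlus n P (i + 1)).scaleArg P (i + 1) with
          coef := -P.q 1 * ((xPlus n P (i + 1)).scaleArg P (i + 1)).coef} := by
  have hn : (n : ℚ) ≠ 0 := by
    have : n ≠ 0 := by omega
    exact_mod_cast this
  ext1
  · funext k j
    have h := congrFun (aStar_recurrence_neg_natCast P hin k.pos) j
    simp only [BosonExpr.normalProd, vertexPsi, vertexPsiStar, BosonExpr.scaleArg, xPlus,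
      Pi.add_apply, Pi.sub_apply, Pi.smul_apply, smul_eq_mul, Nat.cast_add, Nat.cast_one] at h ⊢
    have hxw := P.q_half_mul_q_neg_half (k : ℕ)
    rw [P.q_eq_half_sq (k : ℕ), P.q_eq_half_sq (-(k : ℕ))] at h
    simp only [P.q_succ_mul]
    generalize P.q ((k : ℕ) / 2) = x at *
    generalize P.q (-(k : ℕ) / 2) = w at *
    linear_combination -P.q (i * (k : ℕ)) * x * h + P.q (i * (k : ℕ)) * (x * aStar P n (i + 1 + 1) (-(k : ℕ)) j + w * aStar P n (i + 1) (-(k : ℕ)) j - x * (P.qInt (k : ℕ))⁻¹ * aVec n K (i + 1) j) * hxw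
  · funext k j
    have h := congrFun (aStar_recurrence_natCast P hin k.pos) j
    simp only [BosonExpr.normalProd, vertexPsi, vertexPsiStar, BosonExpr.scaleArg, xPlus,
      Pi.add_apply, Pi.sub_apply, Pi.smul_apply, smul_eq_mul, Nat.cast_add, Nat.cast_one] at h ⊢
    have hxw := P.q_half_mul_q_neg_half (k : ℕ)
    rw [P.q_eq_half_sq (k : ℕ), P.q_eq_half_sq (-(k : ℕ))] at h
    simp only [P.q_neg_three_halves, P.q_neg_succ_mul]
    generalize P.q ((k : ℕ) / 2) = x at *
    generalize P.q (-(k : ℕ) / 2) = w at *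
    linear_combination -P.q (-(i * (k : ℕ))) * w ^ 3 * h + P.q (-(i * (k : ℕ))) * w * aStar P n (i + 1) (k : ℕ) j * (x * w + 1) * hxw
  · simp only [BosonExpr.normalProd, vertexPsi, vertexPsiStar, BosonExpr.scaleArg, xPlus,
      root_succ_eq]
    abel
  · simp only [BosonExpr.normalProd, vertexPsi, vertexPsiStar, BosonExpr.scaleArg, xPlus,
      toRat_root_succ]
    abel
  · simp only [BosonExpr.normalProd, vertexPsi, vertexPsiStar, BosonExpr.scaleArg, xPlus,
      toRat_root_succ]
    push_cast
    module
  · simp only [BosonExpr.normalProd, vertexPsi, vertexPsiStar, BosonExpr.scaleArg, xPlus]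
    module
  · simp only [BosonExpr.normalProd, vertexPsi, vertexPsiStar, BosonExpr.scaleArg, xPlus]
    push_cast
    field_simp
    ring
  · simp only [BosonExpr.normalProd, vertexPsi, vertexPsiStar, BosonExpr.scaleArg, xPlus,
      cCoef_mul_cStarCoef P hin]
    simp

/-- The half-shifts of the arguments are chosen so that the creation coefficients become `±1/[k]`
and cancel, whereas the annihilation coefficients become `q^k/[k]` and `-q^(-k)/[k]`. Opposite
shifts exchange these roles and give `φ_i`. -/
theorem normalProd_xPlus_xMinus_eq_psiCur (i : ℕ) :
    ((xPlus n P i).scaleArg P (1 / 2)).normalProd ((xMinus n P i).scaleArg P (-1 / 2))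
      = {psiCur n P i with zExp := (psiCur n P i).zExp + 2} := by
  ext1
  · funext k j
    simp only [BosonExpr.normalProd, BosonExpr.scaleArg, xPlus, xMinus, psiCur,
      Pi.add_apply, Pi.zero_apply, Pi.smul_apply, smul_eq_mul]
    ring_nf
  · funext k j
    have h := P.sub_div_qInt k.pos
    simp only [BosonExpr.normalProd, BosonExpr.scaleArg, xPlus, xMinus, psiCur,
      Pi.add_apply, Pi.smul_apply, smul_eq_mul]
    rw [P.q_eq_half_sq (k : ℕ), P.q_eq_half_sq (-(k : ℕ))] at h
    rw [show -(1 / 2 * ((k : ℕ) : ℚ)) = -(k : ℕ) / 2 by ring,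
      show -(-1 / 2 * ((k : ℕ) : ℚ)) = (k : ℕ) / 2 by ring]
    linear_combination aVec n K i j * h
  · simp [BosonExpr.normalProd, BosonExpr.scaleArg, xPlus, xMinus, psiCur]
  · simp [BosonExpr.normalProd, BosonExpr.scaleArg, xPlus, xMinus, psiCur]
  · simp only [BosonExpr.normalProd, BosonExpr.scaleArg, xPlus, xMinus, psiCur]
    module
  · simp [BosonExpr.normalProd, BosonExpr.scaleArg, xPlus, xMinus, psiCur]
  · simp only [BosonExpr.normalProd, BosonExpr.scaleArg, xPlus, xMinus, psiCur]
    norm_num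
  · simp only [BosonExpr.normalProd, BosonExpr.scaleArg, xPlus, xMinus, psiCur, mul_one,
      ← P.q_add]
    norm_num [P.q_zero]

theorem normalProd_xPlus_xMinus_eq_phiCur (i : ℕ) :
    ((xPlus n P i).scaleArg P (-1 / 2)).normalProd ((xMinus n P i).scaleArg P (1 / 2))
      = {phiCur n P i with zExp := (phiCur n P i).zExp + 2} := by
  ext1
  · funext k j
    have h := P.sub_div_qInt k.pos
    simp only [BosonExpr.normalProd, BosonExpr.scaleArg, xPlus, xMinus, phiCur,
      Pi.add_apply, Pi.smul_apply, smul_eq_mul]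
    rw [P.q_eq_half_sq (k : ℕ), P.q_eq_half_sq (-(k : ℕ))] at h
    rw [show -1 / 2 * ((k : ℕ) : ℚ) = -(k : ℕ) / 2 by ring,
      show 1 / 2 * ((k : ℕ) : ℚ) = (k : ℕ) / 2 by ring]
    linear_combination -aVec n K i j * h
  · funext k j
    simp only [BosonExpr.normalProd, BosonExpr.scaleArg, xPlus, xMinus, phiCur,
      Pi.add_apply, Pi.zero_apply, Pi.smul_apply, smul_eq_mul]
    ring_nf
  · simp [BosonExpr.normalProd, BosonExpr.scaleArg, xPlus, xMinus, phiCur]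
  · simp [BosonExpr.normalProd, BosonExpr.scaleArg, xPlus, xMinus, phiCur]
  · simp only [BosonExpr.normalProd, BosonExpr.scaleArg, xPlus, xMinus, phiCur]
    module
  · simp [BosonExpr.normalProd, BosonExpr.scaleArg, xPlus, xMinus, phiCur]
  · simp only [BosonExpr.normalProd, BosonExpr.scaleArg, xPlus, xMinus, phiCur]
    norm_num
  · simp only [BosonExpr.normalProd, BosonExpr.scaleArg, xPlus, xMinus, phiCur, mul_one,
      ← P.q_add]
    norm_num [P.q_zero]

end NormalProducts

end QVertex

theorem theorem3p5 {K : Type*} [Field K] [CharZero K] (P : QVertex.QPowers K)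
    (n i : ℕ) (hi : 1 ≤ i) (hin : i < n) :
    ((QVertex.vertexPhi n P (i - 1) (i - 1)).normalProd (QVertex.vertexPhiStar n P i i)).toField P
        = ((QVertex.xMinus n P i).toField P).scaleArg P i ∧
    ((QVertex.vertexPsi n P (i - 1) i).normalProd
          (QVertex.vertexPsiStar n P i (i - 1))).toField P
        = (-P.q 1) • ((QVertex.xPlus n P i).toField P).scaleArg P i ∧
    (((QVertex.xPlus n P i).scaleArg P (1 / 2)).normalProd
          ((QVertex.xMinus n P i).scaleArg P (-1 / 2))).toField P
        = ((QVertex.psiCur n P i).toField P).mulZPow 2 ∧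
    (((QVertex.xPlus n P i).scaleArg P (-1 / 2)).normalProd
          ((QVertex.xMinus n P i).scaleArg P (1 / 2))).toField P
        = ((QVertex.phiCur n P i).toField P).mulZPow 2 := by
  -- Shifting the index turns the truncated subtraction `i - 1` into a genuine predecessor.
  obtain ⟨i, rfl⟩ := Nat.exists_eq_add_of_le' hi
  rw [Nat.add_sub_cancel, Nat.cast_add, Nat.cast_one,
    QVertex.normalProd_vertexPhi_vertexPhiStar P hin,
    QVertex.normalProd_vertexPsi_vertexPsiStar P hin,
    QVertex.normalProd_xPlus_xMinus_eq_psiCur, QVertex.normalProd_xPlus_xMinus_eq_phiCur,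
    QVertex.BosonExpr.toField_smul_coef, QVertex.BosonExpr.toField_add_zExp,
    QVertex.BosonExpr.toField_add_zExp, QVertex.BosonExpr.toField_scaleArg,
    QVertex.BosonExpr.toField_scaleArg]
  exact ⟨rfl, rfl, rfl, rfl⟩
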